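/- Theorem (Existence of the POGAMP). Let $d\ge 1$, let $S\subset\mathbb R^d$ be compact, let $\mathcal Y=C(S,\mathbb R)$ be the Banach space of continuous real functions on $S$ with its Borel $\sigma$-algebra, and let $\mathcal N$ be the space of finite subsets (point patterns) of $S$ with the Borel $\sigma$-algebra of the topology of weak convergence. Let: - $\lambda:S\to[0,\infty)$ be Lebesgue integrable on $S$; - $\mathcal X\subset\mathbb R$ be Borel and, for every $n\ge 0$ and all distinct $s_1,\dots,s_n\in S$, let $f_n(s,\cdot)$ be a Lebesgue probability density on $\mathbb R^n$ that vanishes outside $\mathcal X^n$, such that $(s,v)\mapsto f_n(s,v)$ is continuous on $\{(s,v)\in S^n\times\mathcal X^n: s_1,\dots,s_n\text{ distinct}\}$ and $f_n$ is invariant under simultaneous permutation of locations and values (so that $f_N$ depends only on the pattern $N$); - $\mu:S\to\mathbb R$ and $\Sigma:S\times S\to\mathbb R$ be the mean and covariance functions of a Gaussian process whose law is carried by $\mathcal Y$ (the base Gaussian process), where the matrix $(\Sigma(s_i,s_j))_{i,j}$ is positive definite for all distinct $s_1,\dots,s_n\in S$. Then there exists a probability measure $\mathcal P$ on $\mathcal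 Y\times\mathcal N$, with the product $\sigma$-algebra, under which the coordinate pair $(Y,N)$ satisfies: (i) $N$ is a Poisson process on $S$ with intensity function $\lambda$: for every Borel set $B\subset S$ the number of points of $N$ in $B$ is Poisson with mean $\int_B\lambda(s)\,ds$, and the numbers of points in pairwise disjoint Borel sets are independent; (ii) conditionally on $N=\{s_1,\dots,s_n\}$, the vector $Y_N=(Y(s_1),\dots,Y(s_n))$ has Lebesgue density $f_n(s,\cdot)$; (iii) conditionally on $N=\{s_1,\dots,s_n\}$ and $Y_N=v$, the restriction of $Y$ to $S\setminus\{s_1,\dots,s_n\}$ is a Gaussian process, namely the base Gaussian process conditioned to take the values $v$ at $s_1,\dots,s_n$. That is, with $A=(\Sigma(s_i,s_j))_{i,j}$, $k(t)=(\Sigma(t,s_1),\dots,\Sigma(t,s_n))^{\top}$ and $\mu_s=(\mu(s_1),\dots,\mu(s_n))^{\top}$, it has mean $t\mapsto\mu(t)+k(t)^{\top}A^{-1}(v-\mu_s)$ and covariance function $(t,u)\mapsto\Sigma(t,u)-k(t)^{\top}A^{-1}k(u)$, whose matrices at distinct points of $S\setminus\{s_1,\dots,s_n\}$ are positive definite.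 Conditional laws in (ii) and (iii) are regular conditional distributions, and the assertions hold for almost every $N$ and almost every $v$. Consequently $Y$ is a stochastic process under $\mathcal P$: each $Y(s)$, $s\in S$, is a random variable, and the finite-dimensional distributions of $Y$ form a consistent family. -/

import Mathlib

open MeasureTheory ProbabilityTheory Matrix

/-- The path space `C(X, ℝ)` carries the Borel `σ`-algebra of its standard (compact-open) topology;
for compact `X` this is the topology of the supremum norm. -/
instance pathMeasurableSpace {X : Type*} [TopologicalSpace X] : MeasurableSpace C(X, ℝ) :=
  borel _

instance pathBorelSpace {X : Type*} [TopologicalSpace X] : BorelSpace C(X, ℝ) :=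
  ⟨rfl⟩

/-- Point patterns in a compact space: finite sets of (pairwise distinct) points. In a compact
space a pattern is locally finite exactly when it is finite. -/
@[ext]
structure PointPattern (X : Type*) where
  /-- the set of points of the pattern -/
  points : Finset X

namespace PointPattern

/-- The number of points of the pattern in `B`. -/
noncomputable def count {X : Type*} (B : Set X) (N : PointPattern X) : ℕ :=
  ((N.points : Set X) ∩ B).ncard

/-- The topology of weak convergence: the coarsest one for which `N ↦ ∑ s ∈ N, φ s` is continuous
for every continuous `φ`. -/
instance {X : Type*} [TopologicalSpace X] : TopologicalSpace (PointPattern X) :=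
  TopologicalSpace.induced
    (fun (N : PointPattern X) (φ : C(X, ℝ)) => ∑ s ∈ N.points, φ s) inferInstance

instance {X : Type*} [TopologicalSpace X] : MeasurableSpace (PointPattern X) :=
  borel _

instance {X : Type*} [TopologicalSpace X] : BorelSpace (PointPattern X) :=
  ⟨rfl⟩

end PointPattern

/-- Under `P`, the random point pattern `N` is a Poisson process with intensity measure `L`:
the number of points in a Borel set `B` is Poisson distributed with parameter `L B`, and the
numbers of points in pairwise disjoint Borel sets are independent. -/
structure IsPoissonProcess {Ω X : Type*} [MeasurableSpace Ω] [MeasurableSpace X]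
    (N : Ω → PointPattern X) (L : Measure X) (P : Measure Ω) : Prop where
  count_law : ∀ B : Set X, MeasurableSet B →
    P.map (fun ω => (N ω).count B) = poissonMeasure (L B).toNNReal
  count_indep : ∀ (k : ℕ) (B : Fin k → Set X), (∀ i, MeasurableSet (B i)) →
    Pairwise (fun i j => Disjoint (B i) (B j)) →
    iIndepFun (fun i ω => (N ω).count (B i)) P

/-- Under `P`, the process `(Y t)` is a Gaussian process with mean function `m` and covariance
function `K`, and the covariance matrices at distinct indices are positive definite. -/
structure IsGaussianProcessWith {Ω T : Type*} [MeasurableSpace Ω]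
    (Y : T → Ω → ℝ) (m : T → ℝ) (K : T → T → ℝ) (P : Measure Ω) : Prop where
  gaussian : IsGaussianProcess Y P
  mean_eq : ∀ t, ∫ ω, Y t ω ∂P = m t
  cov_eq : ∀ t u, covariance (Y t) (Y u) P = K t u
  posDef : ∀ (k : ℕ) (t : Fin k → T), Function.Injective t →
    (Matrix.of fun i j => K (t i) (t j)).PosDef

/-- A real stochastic process whose index set is `T`: every `Y t` is a random variable, and the
finite-dimensional distributions form a consistent family. -/
structure IsStochasticProcess {Ω T : Type*} [MeasurableSpace Ω]
    (Y : T → Ω → ℝ) (P : Measure Ω) : Prop where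
  measurable : ∀ t, Measurable (Y t)
  consistent : IsProjectiveMeasureFamily (α := fun _ : T => ℝ)
    (fun I : Finset T => P.map (fun ω => I.restrict (fun t => Y t ω)))

/-- A family of multivariate densities: `f n s` is a probability density on `ℝⁿ`, concentrated on
`Xⁿ`, for every `n`-tuple `s` of distinct locations. It is continuous jointly in the locations and
the values, and it does not depend on the order in which the locations are listed. -/
structure IsDensityFamily {S : Type*} [TopologicalSpace S] (X : Set ℝ)
    (f : ∀ n : ℕ, (Fin n → S) → (Fin n → ℝ) → ℝ) : Prop where
  nonneg : ∀ (n : ℕ) (s : Fin n → S), Function.Injective s → ∀ v, 0 ≤ f n s v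
  lintegral_eq_one : ∀ (n : ℕ) (s : Fin n → S), Function.Injective s →
    ∫⁻ v, ENNReal.ofReal (f n s v) = 1
  eq_zero : ∀ (n : ℕ) (s : Fin n → S), Function.Injective s →
    ∀ v, (∃ i, v i ∉ X) → f n s v = 0
  continuousOn : ∀ n : ℕ, ContinuousOn (fun p : (Fin n → S) × (Fin n → ℝ) => f n p.1 p.2)
    {p | Function.Injective p.1 ∧ ∀ i, p.2 i ∈ X}
  symm : ∀ (n : ℕ) (s : Fin n → S), Function.Injective s → ∀ (σ : Equiv.Perm (Fin n)) v,
    f n (s ∘ σ) (v ∘ σ) = f n s v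

/-- Mean of the Gaussian process with mean `m` and covariance `K` at `t`, given that its values
at `s` are `v`. -/
noncomputable def condMean {S : Type*} (m : S → ℝ) (K : S → S → ℝ) {n : ℕ} (s : Fin n → S)
    (v : Fin n → ℝ) (t : S) : ℝ :=
  m t + (fun i => K t (s i)) ⬝ᵥ ((Matrix.of fun i j => K (s i) (s j))⁻¹ *ᵥ fun i => v i - m (s i))

/-- Covariance at `(t, u)` of the Gaussian process with covariance `K`, given its values at `s`. -/
noncomputable def condCov {S : Type*} (K : S → S → ℝ) {n : ℕ} (s : Fin n → S) (t u : S) : ℝ :=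
  K t u - (fun i => K t (s i)) ⬝ᵥ ((Matrix.of fun i j => K (s i) (s j))⁻¹ *ᵥ fun i => K (s i) u)

/-- `Q`, a law on the path space, is a law of `Y` given `N = {s 1, …, s n}` as the hierarchical
specification prescribes: `Y` at `s` has density `f n s`, and, given these values, `Y` off the
pattern is the base Gaussian process conditioned on taking these values. -/
structure IsPatternLaw {S : Type*} [TopologicalSpace S]
    (f : ∀ n : ℕ, (Fin n → S) → (Fin n → ℝ) → ℝ) (m : S → ℝ) (K : S → S → ℝ)
    {n : ℕ} (s : Fin n → S) (Q : Measure C(S, ℝ)) : Prop where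
  density : Q.map (fun y i => y (s i)) = volume.withDensity (fun v => ENNReal.ofReal (f n s v))
  conditional : ∃ η : Kernel (Fin n → ℝ) C(S, ℝ), IsMarkovKernel η ∧
    HasCondDistrib id (fun y i => y (s i)) η Q ∧
    ∀ᵐ v ∂(Q.map (fun y i => y (s i))),
      IsGaussianProcessWith (fun (t : {t : S // t ∉ Set.range s}) (y : C(S, ℝ)) => y t)
        (fun t => condMean m K s v t) (fun t u => condCov K s t u) (η v)

/-- The defining properties of the Poisson-Gaussian mixture process: under `P`, the second
coordinate `N` is a Poisson process with intensity function `lam` (relative to `leb`), and there is a regular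
conditional law of the first coordinate `Y` given `N` that obeys the hierarchical specification
for almost every pattern (under every enumeration `s` of the pattern). -/
structure IsPOGAMP {S : Type*} [TopologicalSpace S] [MeasurableSpace S] (leb : Measure S)
    (lam : S → ℝ)
    (f : ∀ n : ℕ, (Fin n → S) → (Fin n → ℝ) → ℝ) (m : S → ℝ) (K : S → S → ℝ)
    (P : Measure (C(S, ℝ) × PointPattern S)) : Prop where
  poisson : IsPoissonProcess Prod.snd (leb.withDensity fun s => ENNReal.ofReal (lam s)) P
  conditional : ∃ κ : Kernel (PointPattern S) C(S, ℝ), IsMarkovKernel κ ∧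
    HasCondDistrib Prod.fst Prod.snd κ P ∧
    ∀ᵐ N ∂(P.map Prod.snd), ∀ (n : ℕ) (s : Fin n → S), Function.Injective s →
      Set.range s = (N.points : Set S) → IsPatternLaw f m K s (κ N)

open Set Filter Topology

open scoped ENNReal NNReal

/-! ### Enumerations of point patterns -/

namespace PointPattern

/-! The measure is built hierarchically: draw a Poisson pattern `N`, draw values at its points from
`f`, then draw the rest of the path by correcting an independent base path. The substance lies in
constructing each conditional law explicitly and checking that it is a kernel.

Poisson part: `poissonLaw` mixes the images of the unnormalised powers `L^n` with weights
`exp(-L(S))/n!`, so no division by `L(S)` occurs. As `L` has no atoms, tuples are almost surely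
injective. A functional multiplicative over points integrates to an exponential series, which gives
the joint characteristic function of the counts and hence their laws and independence.

Gaussian part: if `y` is a base path, then `y + k(·)ᵀ A⁻¹ (v - y_s)` takes the values `v` at `s`,
and it is a deterministic term plus a residual linear in `y`. Mean and covariance are read off
(`isGaussianProcessWith_kriging`). The correction stays in the path space because `K` is continuous,
which continuity of the paths forces (`continuous_cov`). Positive definiteness off the pattern is
that of a Schur complement.

Measurability: patterns have no given order, but a Borel injection of `S` into the line selects one
increasing enumeration of each. By Lusin–Souslin, measurability on patterns reduces to measurability
on tuples (`measurable_of_ofTuple`). Permutation invariance makes the conditional law a function of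
the pattern alone. -/

/-- The pattern listed by a tuple. -/
noncomputable def ofTuple {S : Type*} {n : ℕ} (s : Fin n → S) : PointPattern S :=
  open Classical in ⟨Finset.univ.image s⟩

lemma coe_points_ofTuple {S : Type*} {n : ℕ} (s : Fin n → S) :
    ((ofTuple s).points : Set S) = range s := by
  simp [ofTuple]

lemma sum_ofTuple {S : Type*} {n : ℕ} {s : Fin n → S} (hs : Function.Injective s) (φ : S → ℝ) :
    ∑ x ∈ (ofTuple s).points, φ x = ∑ i, φ (s i) := by
  classical
  simp only [ofTuple]
  rw [Finset.sum_image fun _ _ _ _ h => hs h]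

lemma count_ofTuple {S : Type*} {n : ℕ} {s : Fin n → S} (hs : Function.Injective s) (B : Set S)
    [DecidablePred (· ∈ B)] :
    (ofTuple s).count B = ∑ i, if s i ∈ B then 1 else 0 := by
  classical
  have : range s ∩ B = ((Finset.univ.filter (s · ∈ B)).image s : Finset S) := by
    ext x
    simp only [mem_inter_iff, mem_range, Finset.coe_image, Finset.coe_filter, Finset.mem_univ,
      true_and, mem_image, mem_ofPred_eq]
    constructor
    · rintro ⟨⟨i, rfl⟩, h⟩
      exact ⟨i, h, rfl⟩
    · rintro ⟨i, h, rfl⟩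
      exact ⟨⟨i, rfl⟩, h⟩
  rw [count, coe_points_ofTuple, this, ncard_coe_finset, Finset.card_image_of_injective _ hs,
    Finset.card_filter]

lemma exists_eq_ofTuple {S : Type*} (N : PointPattern S) :
    ∃ (n : ℕ) (s : Fin n → S), Function.Injective s ∧ ofTuple s = N := by
  refine ⟨N.points.card, fun i => N.points.equivFin.symm i,
    Subtype.val_injective.comp N.points.equivFin.symm.injective, ?_⟩
  ext x
  rw [← Finset.mem_coe, coe_points_ofTuple]
  constructor
  · rintro ⟨i, rfl⟩
    exact (N.points.equivFin.symm i).2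
  · exact fun hx => ⟨N.points.equivFin ⟨x, hx⟩, by simp⟩

/-- Every pattern has an enumeration that is strictly increasing along a given injection. -/
lemma exists_eq_ofTuple_strictMono {S : Type*} {e : S → ℝ} (he : Function.Injective e)
    (N : PointPattern S) : ∃ (n : ℕ) (s : Fin n → S), StrictMono (e ∘ s) ∧ ofTuple s = N := by
  classical
  set t := (N.points.image e).orderEmbOfFin rfl with ht
  have h (i) : ∃ x ∈ N.points, e x = t i :=
    Finset.mem_image.1 (Finset.orderEmbOfFin_mem (N.points.image e) rfl i)
  choose s hs hst using h
  refine ⟨_, s, ?_, ?_⟩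
  · rw [show e ∘ s = t from funext hst]
    exact t.strictMono
  · ext x
    rw [← Finset.mem_coe, coe_points_ofTuple]
    constructor
    · rintro ⟨i, rfl⟩
      exact hs i
    · intro hx
      have : e x ∈ range t := by
        rw [ht, Finset.range_orderEmbOfFin]
        exact Finset.mem_coe.2 (Finset.mem_image_of_mem e hx)
      obtain ⟨i, hi⟩ := this
      exact ⟨i, he ((hst i).trans hi)⟩

lemma ofTuple_injOn_strictMono {S : Type*} {e : S → ℝ} (he : Function.Injective e) (n : ℕ) :
    InjOn (ofTuple (S := S) (n := n)) {s | StrictMono (e ∘ s)} := by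
  intro s hs t ht h
  have hr : range (e ∘ s) = range (e ∘ t) := by
    rw [range_comp, range_comp, ← coe_points_ofTuple, ← coe_points_ofTuple, h]
  have := (StrictMono.range_inj hs ht).1 hr
  exact funext fun i => he (congrFun this i)

/-! ### Weak topology and Borel structure of the pattern space -/

section Topology

variable {S : Type*} [TopologicalSpace S]

/-- Injectivity is essential: when two points merge, the set forgets the multiplicity and the sums
against test functions jump. -/
lemma continuousOn_ofTuple (n : ℕ) :
    ContinuousOn (ofTuple (S := S) (n := n)) {s | Function.Injective s} := by
  rw [continuousOn_iff_continuous_domRestrict, continuous_induced_rng, continuous_pi_iff]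
  intro φ
  have : (fun s : {s : Fin n → S | Function.Injective s} => ∑ i, φ (s.1 i)) = fun s =>
      ((fun (N : PointPattern S) (φ : C(S, ℝ)) => ∑ s ∈ N.points, φ s) ∘
        domRestrict {s | Function.Injective s} ofTuple) s φ := by
    funext s
    exact (sum_ofTuple s.2 φ).symm
  rw [← this]
  exact continuous_finsetSum _ fun i _ =>
    φ.continuous.comp ((continuous_apply i).comp continuous_subtype_val)

/-- A Urysohn function equal to 1 at a point of one pattern and 0 at all other points of both
detects that point. The Hausdorff property serves the Lusin–Souslin theorem. -/
instance [T4Space S] : T2Space (PointPattern S) := by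
  refine T2Space.of_injective_continuous
    (f := fun (N : PointPattern S) (φ : C(S, ℝ)) => ∑ s ∈ N.points, φ s) ?_ continuous_induced_dom
  have key (N M : PointPattern S) (h : ∀ φ : C(S, ℝ), ∑ s ∈ N.points, φ s = ∑ s ∈ M.points, φ s)
      (x : S) (hx : x ∈ N.points) : x ∈ M.points := by
    classical
    by_contra hxM
    have hF : ((N.points ∪ M.points).erase x : Set S).Finite := Finset.finite_toSet _
    obtain ⟨φ, h0, h1, -⟩ := exists_continuous_zero_one_of_isClosed hF.isClosed
      (isClosed_singleton (x := x)) (by simp)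
    have hN : ∑ s ∈ N.points, φ s = 1 := by
      rw [Finset.sum_eq_single x (fun y hy hyx => h0 (by simp [hy, hyx])) (by simp [hx])]
      exact h1 rfl
    have hM : ∑ s ∈ M.points, φ s = 0 := Finset.sum_eq_zero fun y hy => h0 (by
      have : y ≠ x := fun h => hxM (h ▸ hy)
      simp [hy, this])
    have := h φ
    rw [hN, hM] at this
    exact one_ne_zero this
  intro N M h
  ext x
  exact ⟨key N M (congrFun h) x, key M N (congrFun h.symm) x⟩

lemma isOpen_setOf_injective [T2Space S] (n : ℕ) : IsOpen {s : Fin n → S | Function.Injective s} := by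
  have : {s : Fin n → S | Function.Injective s} = ⋂ p : {p : Fin n × Fin n // p.1 ≠ p.2},
      {s | s p.1.1 ≠ s p.1.2} := by
    ext s
    simp only [mem_ofPred_eq, mem_iInter, Subtype.forall, Prod.forall, Function.Injective]
    exact forall₂_congr fun i j => not_imp_not.symm
  rw [this]
  exact isOpen_iInter_of_finite fun p =>
    isOpen_ne_fun (continuous_apply _) (continuous_apply _)

variable [PolishSpace S] [MeasurableSpace S] [BorelSpace S]

lemma measurableSet_injective (n : ℕ) : MeasurableSet {s : Fin n → S | Function.Injective s} :=
  (isOpen_setOf_injective n).measurableSet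

/-- A function of patterns is measurable as soon as it is a measurable function of the tuples that
list them. -/
theorem measurable_of_ofTuple {β : Type*} [MeasurableSpace β] {F : PointPattern S → β}
    (G : ∀ n : ℕ, (Fin n → S) → β) (hG : ∀ n, Measurable (G n))
    (h : ∀ (n : ℕ) (s : Fin n → S), Function.Injective s → F (ofTuple s) = G n s) :
    Measurable F := by
  obtain ⟨e, he⟩ := exists_measurableEmbedding_real S
  have hinj {n : ℕ} {s : Fin n → S} (hs : StrictMono (e ∘ s)) : Function.Injective s :=
    hs.injective.of_comp
  have hmono (n : ℕ) : MeasurableSet {s : Fin n → S | StrictMono (e ∘ s)} := by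
    have : {s : Fin n → S | StrictMono (e ∘ s)} =
        ⋂ i, ⋂ j, {s | i < j → e (s i) < e (s j)} := by
      ext s
      simp [StrictMono]
    rw [this]
    refine MeasurableSet.iInter fun i => MeasurableSet.iInter fun j => ?_
    by_cases hij : i < j
    · simp only [hij, true_imp_iff]
      exact measurableSet_lt (he.measurable.comp (measurable_pi_apply i))
        (he.measurable.comp (measurable_pi_apply j))
    · simp [hij]
  intro A hA
  -- Restricting to increasing tuples makes `ofTuple` injective, so each piece is a continuous
  -- injective image of a Borel set, hence Borel.
  have : F ⁻¹' A = ⋃ n, ofTuple '' ({s : Fin n → S | StrictMono (e ∘ s)} ∩ G n ⁻¹' A) := by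
    ext N
    simp only [mem_preimage, mem_iUnion, mem_image, mem_inter_iff, mem_ofPred_eq]
    constructor
    · intro hN
      obtain ⟨n, s, hs, rfl⟩ := exists_eq_ofTuple_strictMono he.injective N
      exact ⟨n, s, ⟨hs, h n s (hinj hs) ▸ hN⟩, rfl⟩
    · rintro ⟨n, s, ⟨hs, hsA⟩, rfl⟩
      rwa [h n s (hinj hs)]
  rw [this]
  exact MeasurableSet.iUnion fun n => ((hmono n).inter (hG n hA)).image_of_continuousOn_injOn
    ((continuousOn_ofTuple n).mono fun s hs => hinj hs.1)
    ((ofTuple_injOn_strictMono he.injective n).mono inter_subset_left)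

lemma measurable_count {B : Set S} (hB : MeasurableSet B) :
    Measurable (count (X := S) B) := by
  classical
  refine measurable_of_ofTuple (fun n s => ∑ i, if s i ∈ B then 1 else 0) (fun n => ?_)
    fun n s hs => count_ofTuple hs B
  refine Finset.measurable_sum _ fun i _ => Measurable.ite ?_ measurable_const measurable_const
  exact measurable_pi_apply i hB

end Topology

end PointPattern

/-! ### The Poisson process with finite atomless intensity -/

namespace PointPattern

variable {S : Type*} [TopologicalSpace S] [PolishSpace S] [MeasurableSpace S] [BorelSpace S]

/-- Each diagonal is null by Fubini, since its sections are singletons; there are finitely many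
diagonals. -/
lemma ae_injective (L : Measure S) [SigmaFinite L] [NullSingletonClass L] (n : ℕ) :
    ∀ᵐ s ∂(Measure.pi fun _ : Fin n => L), Function.Injective s := by
  have key (i j : Fin n) (hij : i ≠ j) : ∀ᵐ s ∂(Measure.pi fun _ : Fin n => L), s i ≠ s j := by
    obtain ⟨n, rfl⟩ : ∃ m, n = m + 1 := ⟨n - 1, by have := i.2; omega⟩
    obtain ⟨k, rfl⟩ := Fin.exists_succAbove_eq hij.symm
    have hmp := measurePreserving_piFinSuccAbove (fun _ : Fin (n + 1) => L) i
    have hms : MeasurableSet {p : S × (Fin n → S) | p.1 ≠ p.2 k} :=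
      (measurableSet_eq_fun (f := fun p : S × (Fin n → S) => p.1) (g := fun p => p.2 k)
        measurable_fst ((measurable_pi_apply k).comp measurable_snd)).compl
    have : ∀ᵐ p ∂(L.prod (Measure.pi fun _ : Fin n => L)), p.1 ≠ p.2 k := by
      rw [← Measure.prod_swap, ae_map_iff measurable_swap.aemeasurable hms]
      refine (Measure.ae_prod_iff_ae_ae (measurable_swap hms)).2 ?_
      refine Eventually.of_forall fun t => ?_
      simp [ae_iff]
    exact hmp.quasiMeasurePreserving.ae this
  have : ∀ᵐ s ∂(Measure.pi fun _ : Fin n => L), ∀ i j, i ≠ j → s i ≠ s j := by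
    simp only [ae_all_iff]
    exact key
  filter_upwards [this] with s hs i j h
  by_contra hij
  exact hs i j hij h

lemma aemeasurable_ofTuple (L : Measure S) [SigmaFinite L] [NullSingletonClass L] (n : ℕ) :
    AEMeasurable (ofTuple (S := S) (n := n)) (Measure.pi fun _ : Fin n => L) := by
  classical
  refine ⟨{s | Function.Injective s}.piecewise ofTuple fun _ => ⟨∅⟩,
    (continuousOn_ofTuple n).measurable_piecewise continuousOn_const (measurableSet_injective n), ?_⟩
  filter_upwards [ae_injective L n] with s hs
  rw [piecewise_eq_of_mem _ _ _ hs]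

/-- The law of the Poisson process with finite intensity measure `L`: a Poisson number of points,
placed independently with law proportional to `L`. -/
noncomputable def poissonLaw (L : Measure S) : Measure (PointPattern S) :=
  Measure.sum fun n : ℕ => ENNReal.ofReal (Real.exp (-L.real univ) / n.factorial) •
    (Measure.pi fun _ : Fin n => L).map ofTuple

instance (L : Measure S) [IsFiniteMeasure L] [NullSingletonClass L] : IsProbabilityMeasure (poissonLaw L) := by
  constructor
  rw [poissonLaw, Measure.sum_apply _ MeasurableSet.univ]
  have h := measure_univ (μ := poissonMeasure (L univ).toNNReal)
  rw [poissonMeasure, Measure.sum_apply _ MeasurableSet.univ] at h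
  rw [← h]
  congr 1 with n
  rw [Measure.smul_apply, Measure.map_apply_of_aemeasurable (aemeasurable_ofTuple L n)
    MeasurableSet.univ, preimage_univ, Measure.pi_univ]
  simp only [Finset.prod_const, Finset.card_univ, Fintype.card_fin, smul_eq_mul, Measure.smul_apply,
    measure_univ, mul_one]
  rw [← ENNReal.ofReal_toReal (a := L univ ^ n) (by finiteness), ← ENNReal.ofReal_mul (by positivity),
    ENNReal.toReal_pow]
  congr 1
  simp only [Measure.real, ENNReal.coe_toNNReal_eq_toReal]
  ring

/-- On `n`-point patterns the integral factorises into the `n`-th power of `∫ g`, and the weights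
turn the sum into an exponential series. -/
lemma integral_poissonLaw_prod (L : Measure S) [IsFiniteMeasure L] [NullSingletonClass L] {g : S → ℂ}
    {F : PointPattern S → ℂ} (hF : Measurable F) (hF_norm : ∀ N, ‖F N‖ ≤ 1)
    (h : ∀ (n : ℕ) (s : Fin n → S), Function.Injective s → F (ofTuple s) = ∏ i, g (s i)) :
    ∫ N, F N ∂(poissonLaw L) = Complex.exp (∫ x, g x ∂L - L.real univ) := by
  have hint : Integrable F (poissonLaw L) :=
    Integrable.of_bound hF.aestronglyMeasurable 1 (Eventually.of_forall hF_norm)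
  rw [poissonLaw] at hint ⊢
  rw [integral_sum_measure hint]
  have hterm (n : ℕ) : ∫ N, F N ∂(ENNReal.ofReal (Real.exp (-L.real univ) / n.factorial) •
      (Measure.pi fun _ : Fin n => L).map ofTuple) =
      Complex.exp (-L.real univ) * ((∫ x, g x ∂L) ^ n / n.factorial) := by
    rw [integral_smul_measure, integral_map (aemeasurable_ofTuple L n) hF.aestronglyMeasurable,
      integral_congr_ae (g := fun s => ∏ i, g (s i)), integral_fintype_prod_eq_prod]
    · rw [ENNReal.toReal_ofReal (by positivity)]
      simp only [Finset.prod_const, Finset.card_univ, Fintype.card_fin, Complex.real_smul]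
      push_cast
      ring
    · filter_upwards [ae_injective L n] with s hs using h n s hs
  simp_rw [hterm]
  rw [tsum_mul_left, (NormedSpace.expSeries_div_hasSum_exp (∫ x, g x ∂L)).tsum_eq,
    ← Complex.exp_eq_exp_ℂ, ← Complex.exp_add]
  ring_nf

lemma integral_poissonLaw_exp_count (L : Measure S) [IsFiniteMeasure L] [NullSingletonClass L] {k : ℕ}
    {B : Fin k → Set S} (hB : ∀ i, MeasurableSet (B i))
    (hd : Pairwise fun i j => Disjoint (B i) (B j)) (t : Fin k → ℝ) :
    ∫ N : PointPattern S, Complex.exp ((∑ j, (N.count (B j) : ℝ) * t j : ℝ) * Complex.I) ∂(poissonLaw L) =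
      ∏ j, Complex.exp ((L (B j)).toNNReal * (Complex.exp (t j * Complex.I) - 1)) := by
  classical
  -- By disjointness at most one indicator is nonzero at `x`, so `exp(i ∑ t_j 1_{B_j})` is affine in
  -- the indicators and integrates at once.
  set g : S → ℂ := fun x => 1 + ∑ j, (B j).indicator (fun _ => Complex.exp (t j * Complex.I) - 1) x
    with hg
  have hgB (x : S) : g x = Complex.exp ((∑ j, (if x ∈ B j then (1 : ℝ) else 0) * t j : ℝ) * Complex.I) := by
    by_cases hx : ∃ j, x ∈ B j
    · obtain ⟨j, hj⟩ := hx
      have hne (i : Fin k) (hi : i ≠ j) : x ∉ B i := fun h => disjoint_left.1 (hd hi) h hj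
      simp only [hg]
      rw [Finset.sum_eq_single j (fun i _ hi => by simp [hne i hi]) (by simp),
        Finset.sum_eq_single j (fun i _ hi => by simp [hne i hi]) (by simp)]
      simp [hj]
    · push Not at hx
      simp [hg, hx]
  rw [integral_poissonLaw_prod L (g := g), ← Complex.exp_sum]
  · congr 1
    rw [hg, integral_add (integrable_const _) (integrable_finsetSum _ fun j _ =>
      (integrable_const _).indicator (hB j)), integral_finsetSum _ fun j _ =>
      (integrable_const _).indicator (hB j)]
    simp only [integral_const, integral_indicator_const _ (hB _), Complex.real_smul, mul_one]
    rw [add_sub_cancel_left]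
    rfl
  · have (j : Fin k) : Measurable fun N : PointPattern S => (N.count (B j) : ℝ) :=
      measurable_from_top.comp (measurable_count (hB j))
    fun_prop
  · intro N
    rw [Complex.norm_exp_ofReal_mul_I]
  · intro n s hs
    simp_rw [hgB]
    rw [← Complex.exp_sum, ← Finset.sum_mul]
    congr 2
    simp_rw [count_ofTuple hs]
    push_cast
    rw [Finset.sum_comm]
    simp_rw [Finset.sum_mul]

theorem isPoissonProcess_poissonLaw (L : Measure S) [IsFiniteMeasure L] [NullSingletonClass L] :
    IsPoissonProcess id L (poissonLaw L) := by
  have hmeas {B : Set S} (hB : MeasurableSet B) :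
      Measurable fun N : PointPattern S => (N.count B : ℝ) :=
    measurable_from_top.comp (measurable_count hB)
  have hlaw {B : Set S} (hB : MeasurableSet B) :
      (poissonLaw L).map (fun N => (N.count B : ℝ)) =
        (poissonMeasure (L B).toNNReal).map (Nat.cast : ℕ → ℝ) := by
    have : IsProbabilityMeasure ((poissonLaw L).map (fun N => (N.count B : ℝ))) :=
      Measure.isProbabilityMeasure_map (hmeas hB).aemeasurable
    have : IsProbabilityMeasure ((poissonMeasure (L B).toNNReal).map (Nat.cast : ℕ → ℝ)) :=
      Measure.isProbabilityMeasure_map measurable_from_top.aemeasurable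
    refine Measure.ext_of_charFun (funext fun t => ?_)
    rw [charFun_map_cast_poissonMeasure, charFun_apply,
      integral_map (hmeas hB).aemeasurable (by fun_prop)]
    have := integral_poissonLaw_exp_count L (k := 1) (B := fun _ => B) (fun _ => hB)
      (fun i j h => absurd (Subsingleton.elim i j) h) fun _ => t
    simp only [Finset.univ_unique, Finset.sum_singleton, Finset.prod_singleton] at this
    rw [← this]
    simp [mul_comm]
  refine ⟨fun B hB => ?_, fun k B hB hd => ?_⟩
  -- Characteristic functions need real-valued counts; the floor map brings the identity back to
  -- natural numbers.
  · have h := congrArg (Measure.map (Nat.floor : ℝ → ℕ)) (hlaw hB)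
    rw [Measure.map_map Nat.measurable_floor (hmeas hB),
      Measure.map_map Nat.measurable_floor measurable_from_top] at h
    simpa [Function.comp_def] using h
  · have h : iIndepFun (fun i (N : PointPattern S) => (N.count (B i) : ℝ)) (poissonLaw L) := by
      rw [iIndepFun_iff_charFun_pi fun i => (hmeas (hB i)).aemeasurable]
      intro t
      have hm : Measurable fun N : PointPattern S =>
          WithLp.toLp 2 fun i => (N.count (B i) : ℝ) := by
        have := fun i => hmeas (hB i)
        fun_prop
      rw [charFun_apply, integral_map hm.aemeasurable (by fun_prop)]
      simp_rw [hlaw (hB _), charFun_map_cast_poissonMeasure]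
      rw [← integral_poissonLaw_exp_count L hB hd]
      simp [PiLp.inner_apply, mul_comm]
    have h' := h.comp (fun _ => (Nat.floor : ℝ → ℕ)) fun _ => Nat.measurable_floor
    simpa [Function.comp_def] using h'

end PointPattern

/-! ### Schur complements and Gaussian preliminaries -/

lemma Matrix.PosDef.schur_complement {p q : Type*} [Fintype p] [Fintype q] [DecidableEq p]
    {A : Matrix p p ℝ} {B : Matrix p q ℝ} {D : Matrix q q ℝ}
    (h : (fromBlocks A B Bᴴ D).PosDef) : (D - Bᴴ * A⁻¹ * B).PosDef := by
  have hA : A.PosDef := h.submatrix (e := Sum.inl) Sum.inl_injective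
  have hD : D.PosDef := h.submatrix (e := Sum.inr) Sum.inr_injective
  have : Invertible A := hA.isUnit.invertible
  refine PosDef.of_dotProduct_mulVec_pos
    (hD.1.sub (isHermitian_conjTranspose_mul_mul B hA.1.inv)) fun y hy => ?_
  -- For fixed `y` this vector minimises the block quadratic form, and the minimum is the form of
  -- the Schur complement at `y`.
  have hne : Sum.elim (-((A⁻¹ * B) *ᵥ y)) y ≠ 0 := fun h0 => hy (by
    funext i
    exact congrFun h0 (Sum.inr i))
  have := h.dotProduct_mulVec_pos hne
  rwa [dotProduct_mulVec, schur_complement_eq₁₁ B D _ _ hA.1, neg_add_cancel, dotProduct_zero,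
    zero_add, ← dotProduct_mulVec] at this

namespace ProbabilityTheory

lemma IsGaussianProcess.add_const {Ω T : Type*} [MeasurableSpace Ω] {P : Measure Ω}
    {X : T → Ω → ℝ} (hX : IsGaussianProcess X P) (c : T → ℝ) :
    IsGaussianProcess (fun t ω => X t ω + c t) P where
  hasGaussianLaw I := by
    have h := hX.hasGaussianLaw I
    have := h.isGaussian_map
    constructor
    have heq : (fun ω => I.restrict fun t => X t ω + c t) =
        (fun x => x + I.restrict c) ∘ fun ω => I.restrict fun t => X t ω := rfl
    rw [heq, ← AEMeasurable.map_map_of_aemeasurable (by fun_prop) h.aemeasurable]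
    infer_instance

/-- The modulus discards the mean, so the variance can be recovered from the integral of a bounded
function. -/
lemma HasGaussianLaw.norm_integral_cexp {Ω : Type*} [MeasurableSpace Ω] {P : Measure Ω}
    {X : Ω → ℝ} (hX : HasGaussianLaw X P) :
    ‖∫ ω, Complex.exp (X ω * Complex.I) ∂P‖ = Real.exp (-(Var[X; P] / 2)) := by
  have h := hX.charFun_map_eq 1
  rw [charFun_apply, integral_map hX.aemeasurable (by fun_prop)] at h
  simp only [mul_one, one_mul, RCLike.inner_apply, conj_trivial, map_one] at h
  rw [h, Complex.norm_exp]
  norm_num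

end ProbabilityTheory

/-! ### Conditioning the base Gaussian process -/

section Gaussian

variable {S : Type*} [TopologicalSpace S] {m : S → ℝ} {K : S → S → ℝ} {G : Measure C(S, ℝ)}

namespace IsGaussianProcessWith

variable (hG : IsGaussianProcessWith (fun (s : S) (y : C(S, ℝ)) => y s) m K G)

include hG

lemma cov_comm (t u : S) : K t u = K u t := by
  rw [← hG.cov_eq, ← hG.cov_eq, covariance_comm]

lemma memLp_eval (t : S) : MemLp (fun y : C(S, ℝ) => y t) 2 G :=
  (hG.gaussian.hasGaussianLaw_eval t).memLp_two

lemma integrable_eval (t : S) : Integrable (fun y : C(S, ℝ) => y t) G :=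
  (hG.gaussian.hasGaussianLaw_eval t).integrable

lemma posDef_tuple {n : ℕ} {s : Fin n → S} (hs : Function.Injective s) :
    (Matrix.of fun i j => K (s i) (s j)).PosDef :=
  hG.posDef n s hs

/-- The covariance function of a Gaussian process with continuous paths is continuous. -/
theorem continuous_cov [FirstCountableTopology S] : Continuous fun p : S × S => K p.1 p.2 := by
  have := hG.gaussian.isProbabilityMeasure
  -- Writing the variance through `E exp(iX)` permits dominated convergence with the constant bound
  -- 1, so no uniform moment bound is needed. Polarisation then passes from variances to
  -- covariances.
  have hvar {X : C(S, ℝ) → ℝ} (hX : HasGaussianLaw X G) :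
      Var[X; G] = -2 * Real.log ‖∫ y, Complex.exp (X y * Complex.I) ∂G‖ := by
    rw [hX.norm_integral_cexp, Real.log_exp]
    ring
  have hlog {F : S × S → C(S, ℝ) → ℝ} (hX : ∀ p, HasGaussianLaw (F p) G)
      (hF : ∀ p, Continuous (F p)) (hF' : ∀ y, Continuous fun p => F p y) :
      Continuous fun p => Var[F p; G] := by
    simp_rw [fun p => hvar (hX p)]
    refine continuous_const.mul (Continuous.log (Continuous.norm ?_) fun p => ?_)
    · refine continuous_of_dominated (bound := fun _ => 1) (fun p => ?_) (fun p => ?_)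
        (integrable_const 1) (Eventually.of_forall fun y => ?_)
      · have := hF p
        exact Continuous.aestronglyMeasurable (by fun_prop)
      · exact Eventually.of_forall fun y => (Complex.norm_exp_ofReal_mul_I _).le
      · have := hF' y
        fun_prop
    · rw [(hX p).norm_integral_cexp]
      exact (Real.exp_pos _).ne'
  have h1 := hlog (F := fun p y => y p.1) (fun p => hG.gaussian.hasGaussianLaw_eval p.1)
    (fun p => by fun_prop) fun y => by fun_prop
  have h2 := hlog (F := fun p y => y p.2) (fun p => hG.gaussian.hasGaussianLaw_eval p.2)
    (fun p => by fun_prop) fun y => by fun_prop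
  have h3 := hlog (F := fun p y => y p.1 - y p.2) (fun p => hG.gaussian.hasGaussianLaw_fun_sub)
    (fun p => by fun_prop) fun y => by fun_prop
  have : (fun p : S × S => K p.1 p.2) = fun p => (Var[fun y : C(S, ℝ) => y p.1; G] +
      Var[fun y : C(S, ℝ) => y p.2; G] - Var[fun y : C(S, ℝ) => y p.1 - y p.2; G]) / 2 := by
    funext p
    have hm := hG.memLp_eval
    rw [← covariance_self (hm p.1).aemeasurable, ← covariance_self (hm p.2).aemeasurable,
      ← covariance_self (X := fun y : C(S, ℝ) => y p.1 - y p.2)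
        ((hm p.1).sub (hm p.2)).aemeasurable,
      covariance_fun_sub_fun_sub (hm _) (hm _) (hm _) (hm _)]
    simp only [hG.cov_eq]
    rw [hG.cov_comm p.2 p.1]
    ring
  rw [this]
  fun_prop

end IsGaussianProcessWith

/-- The path `y` of the base process, corrected so as to take the values `v` at the locations `s`.
Here `Kc x` is the covariance function as a function of its first argument, the second one being
`x`. -/
noncomputable def kriging (Kc : C(S, C(S, ℝ))) {n : ℕ} (s : Fin n → S) (v : Fin n → ℝ)
    (y : C(S, ℝ)) : C(S, ℝ) :=
  y + ∑ i, ((Matrix.of fun i j => Kc (s j) (s i))⁻¹ *ᵥ fun i => v i - y (s i)) i • Kc (s i)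

variable {Kc : C(S, C(S, ℝ))}

lemma kriging_apply (hK : ∀ x t, Kc x t = K t x) {n : ℕ} (s : Fin n → S) (v : Fin n → ℝ)
    (y : C(S, ℝ)) (t : S) :
    kriging Kc s v y t = y t + (fun i => K t (s i)) ⬝ᵥ
      ((Matrix.of fun i j => K (s i) (s j))⁻¹ *ᵥ fun i => v i - y (s i)) := by
  simp [kriging, hK, dotProduct, ContinuousMap.sum_apply, mul_comm]

lemma kriging_apply_self (hK : ∀ x t, Kc x t = K t x) {n : ℕ} {s : Fin n → S}
    (hs : (Matrix.of fun i j => K (s i) (s j)).PosDef) (v : Fin n → ℝ) (y : C(S, ℝ)) :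
    (fun i => kriging Kc s v y (s i)) = v := by
  funext j
  rw [kriging_apply hK]
  have h : (Matrix.of fun i j => K (s i) (s j)) *ᵥ ((Matrix.of fun i j => K (s i) (s j))⁻¹ *ᵥ
      fun i => v i - y (s i)) = fun i => v i - y (s i) := by
    rw [mulVec_mulVec, mul_nonsing_inv _ ((isUnit_iff_isUnit_det _).1 hs.isUnit), one_mulVec]
  have := congrFun h j
  simp only [mulVec] at this ⊢
  rw [show (fun i => K (s j) (s i)) = (Matrix.of fun i j => K (s i) (s j)) j from rfl, this]
  ring

/-- Matrix inversion commutes with simultaneous reindexing of rows and columns, so the correction is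
the same sum in another order. -/
lemma kriging_comp_perm {n : ℕ} (s : Fin n → S) (σ : Equiv.Perm (Fin n)) (v : Fin n → ℝ)
    (y : C(S, ℝ)) : kriging Kc (s ∘ σ) (v ∘ σ) y = kriging Kc s v y := by
  have h : (Matrix.of fun i j => Kc ((s ∘ σ) j) ((s ∘ σ) i))⁻¹ =
      (Matrix.of fun i j => Kc (s j) (s i))⁻¹.submatrix σ σ := by
    rw [← inv_submatrix_equiv]
    rfl
  simp only [kriging, h]
  rw [← Equiv.sum_comp σ fun i => ((Matrix.of fun i j => Kc (s j) (s i))⁻¹ *ᵥ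
    fun i => v i - y (s i)) i • Kc (s i)]
  congr 1
  refine Finset.sum_congr rfl fun i _ => ?_
  congr 1
  simp only [mulVec, dotProduct, submatrix_apply, Function.comp_apply]
  exact Equiv.sum_comp σ fun j => (Matrix.of fun i j => Kc (s j) (s i))⁻¹ (σ i) j * (v j - y (s j))

lemma measurable_kriging [CompactSpace S] [PolishSpace S] [MeasurableSpace S] [BorelSpace S]
    (Kc : C(S, C(S, ℝ))) (n : ℕ) :
    Measurable fun p : (Fin n → S) × (Fin n → ℝ) × C(S, ℝ) => kriging Kc p.1 p.2.1 p.2.2 := by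
  have heval : Measurable fun p : C(S, ℝ) × S => p.1 p.2 := continuous_eval.measurable
  have hKs (i : Fin n) : Measurable fun p : (Fin n → S) × (Fin n → ℝ) × C(S, ℝ) => Kc (p.1 i) :=
    Kc.continuous.measurable.comp ((measurable_pi_apply i).comp measurable_fst)
  have hKss (i j : Fin n) :
      Measurable fun p : (Fin n → S) × (Fin n → ℝ) × C(S, ℝ) => Kc (p.1 j) (p.1 i) :=
    heval.comp ((hKs j).prodMk ((measurable_pi_apply i).comp measurable_fst))
  have hy (i : Fin n) : Measurable fun p : (Fin n → S) × (Fin n → ℝ) × C(S, ℝ) => p.2.2 (p.1 i) :=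
    heval.comp ((measurable_snd.comp measurable_snd).prodMk
      ((measurable_pi_apply i).comp measurable_fst))
  have hv (i : Fin n) : Measurable fun p : (Fin n → S) × (Fin n → ℝ) × C(S, ℝ) => p.2.1 i :=
    (measurable_pi_apply i).comp (measurable_fst.comp measurable_snd)
  have hdet (f : Fin n → Fin n → (Fin n → S) × (Fin n → ℝ) × C(S, ℝ) → ℝ)
      (hf : ∀ i j, Measurable (f i j)) : Measurable fun p => (Matrix.of fun i j => f i j p).det := by
    simp_rw [det_apply]
    exact Finset.measurable_sum _ fun σ _ =>
      (Finset.measurable_prod _ fun i _ => hf _ _).const_smul _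
  have hinv (i j : Fin n) : Measurable fun p : (Fin n → S) × (Fin n → ℝ) × C(S, ℝ) =>
      (Matrix.of fun i j => Kc (p.1 j) (p.1 i))⁻¹ i j := by
    -- Cramer's rule reduces the entries to determinants. Singular matrices get the inverse 0, so
    -- measurability holds on all tuples, including those with repeated points.
    simp_rw [inv_def, Matrix.smul_apply, adjugate_apply, Ring.inverse_eq_inv', smul_eq_mul]
    have hrow (p : (Fin n → S) × (Fin n → ℝ) × C(S, ℝ)) :
        (Matrix.of fun i j => Kc (p.1 j) (p.1 i)).updateRow j (Pi.single i 1) =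
          Matrix.of fun k l => if k = j then (Pi.single i 1 : Fin n → ℝ) l
            else Kc (p.1 l) (p.1 k) := by
      ext k l
      simp [updateRow_apply]
    simp_rw [hrow]
    refine (hdet _ hKss).inv.mul (hdet _ fun k l => ?_)
    by_cases hk : k = j
    · simp [hk]
    · simpa [hk] using hKss k l
  refine (measurable_snd.comp measurable_snd).add (Finset.measurable_sum _ fun i _ => ?_)
  refine Measurable.fun_smul ?_ (hKs i)
  simp only [mulVec, dotProduct]
  exact Finset.measurable_sum _ fun j _ => (hinv i j).mul ((hv j).sub (hy j))

/-- The law of the base process, corrected so as to take the values `v` at the locations `s`, is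
the law of the base process conditioned on these values. -/
theorem isGaussianProcessWith_kriging [CompactSpace S] [PolishSpace S] [MeasurableSpace S]
    [BorelSpace S] (hG : IsGaussianProcessWith (fun (s : S) (y : C(S, ℝ)) => y s) m K G)
    (hK : ∀ x t, Kc x t = K t x) {n : ℕ} {s : Fin n → S} (hs : Function.Injective s)
    (v : Fin n → ℝ) :
    IsGaussianProcessWith (fun (t : {t : S // t ∉ range s}) (y : C(S, ℝ)) => y t)
      (fun t => condMean m K s v t) (fun t u => condCov K s t u) (G.map (kriging Kc s v)) := by
  classical
  have := hG.gaussian.isProbabilityMeasure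
  have hA := hG.posDef_tuple hs
  set A := Matrix.of fun i j => K (s i) (s j) with hA_def
  have hΦ : Measurable (kriging Kc s v) :=
    (measurable_kriging Kc n).comp (measurable_const.prodMk (measurable_const.prodMk measurable_id))
  -- `b t` is the row `k(t)ᵀ A⁻¹`. The corrected path at `t` is the residual `y t - b t ⬝ᵥ y_s`,
  -- linear in `y` and hence Gaussian, plus the constant `b t ⬝ᵥ v`.
  set b : S → Fin n → ℝ := fun t => (fun i => K t (s i)) ᵥ* A⁻¹ with hb
  have heq (t : S) (y : C(S, ℝ)) :
      kriging Kc s v y t = (y t - ∑ i, b t i * y (s i)) + b t ⬝ᵥ v := by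
    rw [kriging_apply hK, dotProduct_mulVec]
    change y t + b t ⬝ᵥ (v - fun i => y (s i)) = _
    rw [dotProduct_sub]
    simp only [dotProduct]
    ring
  have hX : IsGaussianProcess (fun (t : {t : S // t ∉ range s}) (y : C(S, ℝ)) =>
      y t - ∑ i, b t i * y (s i)) G := by
    refine hG.gaussian.of_isGaussianProcess fun t => ⟨insert t.1 (Finset.univ.image s),
      LinearMap.toContinuousLinearMap
        { toFun x := x ⟨t, by simp⟩ - ∑ i, b t i * x ⟨s i, by simp⟩
          map_add' x y := by
            simp only [Pi.add_apply, mul_add, Finset.sum_add_distrib]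
            ring
          map_smul' c x := by
            simp only [Pi.smul_apply, smul_eq_mul, RingHom.id_apply, mul_sub, Finset.mul_sum]
            congr 1
            exact Finset.sum_congr rfl fun i _ => by ring },
      fun y => rfl⟩
  have hY := hX.add_const fun t => b t ⬝ᵥ v
  have hsum (t : S) : MemLp (fun y : C(S, ℝ) => ∑ i, b t i * y (s i)) 2 G :=
    memLp_finsetSum _ fun i _ => (hG.memLp_eval (s i)).const_mul (b t i)
  have hdiff (t : S) : MemLp (fun y : C(S, ℝ) => y t - ∑ i, b t i * y (s i)) 2 G :=
    (hG.memLp_eval t).sub (hsum t)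
  have hev (t : S) : Continuous fun y : C(S, ℝ) => y t := by fun_prop
  refine ⟨⟨fun I => ?_⟩, fun t => ?_, fun t u => ?_, fun k t ht => ?_⟩
  · constructor
    rw [Measure.map_map _ hΦ]
    · convert! (hY.hasGaussianLaw I).isGaussian_map using 3 with y
      exact funext fun t => heq t y
    · exact measurable_pi_lambda _ fun t => (hev _).measurable
  · rw [integral_map hΦ.aemeasurable
      (hev _).aestronglyMeasurable]
    simp_rw [heq]
    rw [integral_add ((hdiff t).integrable one_le_two) (integrable_const _),
      integral_sub (hG.integrable_eval t) ((hsum t).integrable one_le_two),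
      integral_finsetSum _ fun i _ => (hG.integrable_eval (s i)).const_mul _]
    simp_rw [integral_const_mul, hG.mean_eq]
    rw [condMean, dotProduct_mulVec]
    change _ = m t + b t ⬝ᵥ (v - fun i => m (s i))
    rw [dotProduct_sub]
    simp only [dotProduct, integral_const, probReal_univ, one_smul]
    ring
  · rw [covariance_map (hev _).aestronglyMeasurable
      (hev _).aestronglyMeasurable hΦ.aemeasurable]
    simp only [Function.comp_def, heq]
    rw [covariance_add_const_left ((hdiff t).integrable one_le_two),
      covariance_add_const_right ((hdiff u).integrable one_le_two),
      covariance_fun_sub_fun_sub (hG.memLp_eval _) (hsum _) (hG.memLp_eval _) (hsum _),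
      covariance_fun_sum_left (fun i => (hG.memLp_eval (s i)).const_mul _) (hG.memLp_eval _),
      covariance_fun_sum_right (fun i => (hG.memLp_eval (s i)).const_mul _) (hG.memLp_eval _),
      covariance_fun_sum_fun_sum (fun i => (hG.memLp_eval (s i)).const_mul _)
        fun i => (hG.memLp_eval (s i)).const_mul _]
    simp_rw [covariance_const_mul_left, covariance_const_mul_right, hG.cov_eq]
    -- Since `b t ᵥ* A = k(t)`, the quadratic term cancels one of the two cross terms in the
    -- covariance of residuals.
    have h1 : ∑ i, ∑ j, b t i * (b u j * K (s i) (s j)) = ∑ j, b u j * K t (s j) := by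
      have : b t ᵥ* A = fun j => K t (s j) := by
        rw [hb, vecMul_vecMul, nonsing_inv_mul _ ((isUnit_iff_isUnit_det _).1 hA.isUnit), vecMul_one]
      rw [Finset.sum_comm]
      refine Finset.sum_congr rfl fun j _ => ?_
      rw [← congrFun this j]
      simp only [vecMul, dotProduct, hA_def, of_apply, Finset.mul_sum]
      exact Finset.sum_congr rfl fun i _ => by ring
    rw [h1, condCov, dotProduct_mulVec]
    change _ = K t u - ∑ i, b t i * K (s i) u
    ring
  · set B : Matrix (Fin n) (Fin k) ℝ := Matrix.of fun i j => K (s i) (t j) with hB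
    -- The points `t` lie off the pattern, so the joined tuple is injective and its full covariance
    -- matrix is positive definite; the conditional covariance is its Schur complement.
    have hinj : Function.Injective (Sum.elim s fun j => (t j : S)) := by
      rintro (i | i) (j | j) hij
      · exact congrArg _ (hs hij)
      · exact absurd ⟨i, hij⟩ (t j).2
      · exact absurd ⟨j, hij.symm⟩ (t i).2
      · exact congrArg _ (ht (Subtype.ext hij))
    have hbig := (hG.posDef (n + k) ((Sum.elim s fun j => (t j : S)) ∘ finSumFinEquiv.symm)
      (hinj.comp finSumFinEquiv.symm.injective)).submatrix finSumFinEquiv.injective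
    have : (fromBlocks A B Bᴴ (Matrix.of fun i j => K (t i) (t j))).PosDef := by
      convert! hbig using 1
      ext (i | i) (j | j)
      · simp [hA_def]
      · simp [hB]
      · simp [hB, hG.cov_comm]
      · simp
    convert! this.schur_complement using 1
    ext i j
    simp only [of_apply, Matrix.sub_apply, condCov, dotProduct_mulVec]
    congr 1
    simp only [Matrix.mul_apply, dotProduct, vecMul, conjTranspose_apply, star_trivial, hB, of_apply]
    simp_rw [hG.cov_comm (s _) (t i), hA_def]

end Gaussian

lemma IsPoissonProcess.of_map {Ω S : Type*} [MeasurableSpace Ω] [TopologicalSpace S]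
    [PolishSpace S] [MeasurableSpace S] [BorelSpace S] {N : Ω → PointPattern S}
    {L : Measure S} {P : Measure Ω} [IsProbabilityMeasure P] (hN : Measurable N)
    (h : IsPoissonProcess id L (P.map N)) : IsPoissonProcess N L P where
  count_law B hB := by
    rw [← h.count_law B hB]
    exact (Measure.map_map (PointPattern.measurable_count hB) hN).symm
  count_indep k B hB hd := by
    have := Measure.isProbabilityMeasure_map (μ := P) hN.aemeasurable
    have hm (i : Fin k) := PointPattern.measurable_count (hB i)
    have := (iIndepFun_iff_map_fun_eq_pi_map fun i => (hm i).aemeasurable).1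
      (h.count_indep k B hB hd)
    rw [Measure.map_map (measurable_pi_lambda _ fun i => hm i) hN] at this
    simp_rw [Measure.map_map (hm _) hN] at this
    exact (iIndepFun_iff_map_fun_eq_pi_map fun i => ((hm i).comp hN).aemeasurable).2 this

/-! ### The law of the path given the pattern -/

section PatternLaw

variable {S : Type*} [TopologicalSpace S] {X : Set ℝ} {f : ∀ n : ℕ, (Fin n → S) → (Fin n → ℝ) → ℝ}
  {m : S → ℝ} {K : S → S → ℝ} {Kc : C(S, C(S, ℝ))} {G : Measure C(S, ℝ)}

/-- The law of the values of the process at the locations `s`. -/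
noncomputable def valueLaw (f : ∀ n : ℕ, (Fin n → S) → (Fin n → ℝ) → ℝ) {n : ℕ} (s : Fin n → S) :
    Measure (Fin n → ℝ) :=
  volume.withDensity fun v => ENNReal.ofReal (f n s v)

/-- The law of the path, given that the pattern is listed by `s`: draw the values at `s`, and
correct an independent path of the base process so as to take these values. -/
noncomputable def patternLaw (f : ∀ n : ℕ, (Fin n → S) → (Fin n → ℝ) → ℝ) (Kc : C(S, C(S, ℝ)))
    (G : Measure C(S, ℝ)) {n : ℕ} (s : Fin n → S) : Measure C(S, ℝ) :=
  ((valueLaw f s).prod G).map fun p => kriging Kc s p.1 p.2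

lemma IsDensityFamily.isProbabilityMeasure_valueLaw (hf : IsDensityFamily X f) {n : ℕ}
    {s : Fin n → S} (hs : Function.Injective s) : IsProbabilityMeasure (valueLaw f s) :=
  ⟨by rw [valueLaw, withDensity_apply _ MeasurableSet.univ, Measure.restrict_univ,
    hf.lintegral_eq_one n s hs]⟩

/-- Permuting coordinates preserves Lebesgue measure, and the density is symmetric under a
simultaneous permutation. -/
lemma IsDensityFamily.map_valueLaw_comp_perm (hf : IsDensityFamily X f) {n : ℕ} {s : Fin n → S}
    (hs : Function.Injective s) (σ : Equiv.Perm (Fin n)) :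
    (valueLaw f s).map (fun v => v ∘ σ) = valueLaw f (s ∘ σ) := by
  set e := MeasurableEquiv.piCongrLeft (fun _ : Fin n => ℝ) σ.symm with he
  have hev (v : Fin n → ℝ) : e v = v ∘ σ := by
    funext i
    have := MeasurableEquiv.piCongrLeft_apply_apply (β := fun _ : Fin n => ℝ) σ.symm v (σ i)
    simpa using this
  have hmp : MeasurePreserving e := volume_measurePreserving_piCongrLeft (fun _ => ℝ) σ.symm
  rw [show (fun v : Fin n → ℝ => v ∘ σ) = e from (funext hev).symm]
  ext A hA
  rw [e.map_apply, valueLaw, valueLaw, withDensity_apply _ hA,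
    withDensity_apply _ (e.measurable hA),
    ← hmp.setLIntegral_comp_preimage_emb e.measurableEmbedding
      (fun w => ENNReal.ofReal (f n (s ∘ σ) w)) A]
  exact lintegral_congr fun v => by rw [hev, hf.symm n s hs]

variable [CompactSpace S] [PolishSpace S] [MeasurableSpace S] [BorelSpace S]

lemma measurable_kriging_right (Kc : C(S, C(S, ℝ))) {n : ℕ} (s : Fin n → S) :
    Measurable fun p : (Fin n → ℝ) × C(S, ℝ) => kriging Kc s p.1 p.2 :=
  (measurable_kriging Kc n).comp (measurable_const.prodMk measurable_id)

lemma isProbabilityMeasure_patternLaw (hf : IsDensityFamily X f) [IsProbabilityMeasure G] {n : ℕ}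
    {s : Fin n → S} (hs : Function.Injective s) : IsProbabilityMeasure (patternLaw f Kc G s) := by
  have := hf.isProbabilityMeasure_valueLaw hs
  exact Measure.isProbabilityMeasure_map (measurable_kriging_right Kc s).aemeasurable

lemma patternLaw_comp_perm (hf : IsDensityFamily X f) [IsProbabilityMeasure G] {n : ℕ}
    {s : Fin n → S} (hs : Function.Injective s) (σ : Equiv.Perm (Fin n)) :
    patternLaw f Kc G (s ∘ σ) = patternLaw f Kc G s := by
  have := hf.isProbabilityMeasure_valueLaw hs
  have hσ : Measurable fun v : Fin n → ℝ => v ∘ σ :=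
    measurable_pi_lambda _ fun i => measurable_pi_apply (σ i)
  have h := Measure.map_prod_map (valueLaw f s) G hσ measurable_id
  rw [Measure.map_id, hf.map_valueLaw_comp_perm hs] at h
  rw [patternLaw, h, Measure.map_map (measurable_kriging_right Kc _) (hσ.prodMap measurable_id)]
  simp only [Function.comp_def, Prod.map, id]
  simp_rw [fun p : (Fin n → ℝ) × C(S, ℝ) =>
    show kriging Kc (fun i => s (σ i)) (fun i => p.1 (σ i)) p.2 = kriging Kc s p.1 p.2 from
      kriging_comp_perm s σ p.1 p.2]
  rfl

/-- Two injective enumerations of one finite set have equal length and differ by a permutation. -/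
lemma patternLaw_eq_of_ofTuple_eq (hf : IsDensityFamily X f) [IsProbabilityMeasure G] {n k : ℕ}
    {s : Fin n → S} {t : Fin k → S} (hs : Function.Injective s) (ht : Function.Injective t)
    (h : range s = range t) : patternLaw f Kc G s = patternLaw f Kc G t := by
  set e : Fin n ≃ Fin k := (Equiv.ofInjective s hs).trans
    ((Equiv.setCongr h).trans (Equiv.ofInjective t ht).symm) with he
  obtain rfl : n = k := by simpa using Fintype.card_congr e
  rw [← patternLaw_comp_perm hf ht e]
  congr 1
  funext i
  simp [he, Equiv.apply_ofInjective_symm ht]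

/-- The laws given the pattern depend measurably on the locations. -/
lemma exists_kernel_eq_patternLaw (hf : IsDensityFamily X f) (hX : MeasurableSet X)
    (Kc : C(S, C(S, ℝ))) (G : Measure C(S, ℝ)) [IsProbabilityMeasure G] (n : ℕ) :
    ∃ κ : Kernel (Fin n → S) C(S, ℝ), ∀ s, Function.Injective s → κ s = patternLaw f Kc G s := by
  classical
  set D : Set ((Fin n → S) × (Fin n → ℝ)) := {p | Function.Injective p.1 ∧ ∀ i, p.2 i ∈ X}
  have hD : MeasurableSet D := by
    refine (measurable_fst (PointPattern.measurableSet_injective n)).inter ?_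
    have : {p : (Fin n → S) × (Fin n → ℝ) | ∀ i, p.2 i ∈ X} =
        ⋂ i, (fun p : (Fin n → S) × (Fin n → ℝ) => p.2 i) ⁻¹' X := by
      ext
      simp
    change MeasurableSet {p : (Fin n → S) × (Fin n → ℝ) | ∀ i, p.2 i ∈ X}
    rw [this]
    exact MeasurableSet.iInter fun i => ((measurable_pi_apply i).comp measurable_snd) hX
  -- The density is jointly continuous only on `D`. Extension by zero is jointly measurable and
  -- changes nothing at injective `s`, where the density vanishes as soon as some value leaves `X`.
  set g : (Fin n → S) → (Fin n → ℝ) → ℝ≥0∞ := fun s v =>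
    ENNReal.ofReal (D.piecewise (fun p => f n p.1 p.2) (fun _ => 0) (s, v))
  have hg : Measurable (Function.uncurry g) :=
    ((hf.continuousOn n).measurable_piecewise continuousOn_const hD).ennreal_ofReal
  have hgf {s : Fin n → S} (hs : Function.Injective s) :
      g s = fun v => ENNReal.ofReal (f n s v) := by
    funext v
    by_cases hv : ∀ i, v i ∈ X
    · simp only [g]
      rw [piecewise_eq_of_mem _ _ _ (show (s, v) ∈ D from ⟨hs, hv⟩)]
    · simp only [g]
      rw [piecewise_eq_of_notMem _ _ _ fun h => hv h.2]
      push Not at hv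
      rw [hf.eq_zero n s hs v hv]
  set ν : Kernel (Fin n → S) (Fin n → ℝ) := (Kernel.const _ volume).withDensity g
  have hν {s : Fin n → S} (hs : Function.Injective s) : ν s = valueLaw f s := by
    rw [Kernel.withDensity_apply _ hg, hgf hs]
    rfl
  have : IsFiniteKernel ν := by
    refine ⟨1, ENNReal.one_lt_top, fun s => ?_⟩
    by_cases hs : Function.Injective s
    · have := hf.isProbabilityMeasure_valueLaw hs
      rw [hν hs, measure_univ]
    · have : g s = 0 := by
        funext v
        simp only [g]
        rw [piecewise_eq_of_notMem _ _ _ fun h => hs h.1]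
        simp
      rw [Kernel.withDensity_apply _ hg, this]
      simp
  refine ⟨(Kernel.id ×ₖ (ν ×ₖ Kernel.const _ G)).map fun p => kriging Kc p.1 p.2.1 p.2.2,
    fun s hs => ?_⟩
  have := hf.isProbabilityMeasure_valueLaw hs
  rw [Kernel.map_apply _ (measurable_kriging Kc n), Kernel.prod_apply, Kernel.prod_apply,
    Kernel.const_apply, Kernel.id_apply, hν hs, Measure.dirac_prod,
    Measure.map_map (measurable_kriging Kc n) measurable_prodMk_left]
  rfl

/-- The corrected path takes exactly the drawn values at `s`, so conditioning on these values fixes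
the first of two independent coordinates. What remains is the image of `G` under the correction, for
every `v`. -/
theorem isPatternLaw_patternLaw (hf : IsDensityFamily X f)
    (hG : IsGaussianProcessWith (fun (s : S) (y : C(S, ℝ)) => y s) m K G)
    (hK : ∀ x t, Kc x t = K t x) {n : ℕ} {s : Fin n → S} (hs : Function.Injective s) :
    IsPatternLaw f m K s (patternLaw f Kc G s) := by
  have := hG.gaussian.isProbabilityMeasure
  have := hf.isProbabilityMeasure_valueLaw hs
  have hk := measurable_kriging_right Kc s
  have hev : Measurable fun (y : C(S, ℝ)) (i : Fin n) => y (s i) :=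
    measurable_pi_lambda _ fun i => Continuous.measurable (by fun_prop)
  have hself : (fun (y : C(S, ℝ)) (i : Fin n) => y (s i)) ∘
      (fun p : (Fin n → ℝ) × C(S, ℝ) => kriging Kc s p.1 p.2) = Prod.fst :=
    funext fun p => kriging_apply_self hK (hG.posDef_tuple hs) p.1 p.2
  have hdensity : (patternLaw f Kc G s).map (fun y i => y (s i)) = valueLaw f s := by
    rw [patternLaw, Measure.map_map hev hk, hself]
    exact Measure.map_fst_prod.trans (by simp)
  refine ⟨hdensity, (Kernel.id ×ₖ Kernel.const _ G).map fun p => kriging Kc s p.1 p.2,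
    Kernel.IsMarkovKernel.map _ hk, ⟨by fun_prop, ?_⟩, Eventually.of_forall fun v => ?_⟩
  · rw [hdensity, patternLaw, Measure.map_map (hev.prodMk measurable_id) hk]
    change ((valueLaw f s).prod G).map (fun p => (((fun (y : C(S, ℝ)) (i : Fin n) => y (s i)) ∘
      (fun p : (Fin n → ℝ) × C(S, ℝ) => kriging Kc s p.1 p.2)) p, kriging Kc s p.1 p.2)) = _
    rw [hself]
    ext A hA
    rw [Measure.map_apply (measurable_fst.prodMk hk) hA, Measure.compProd_apply hA,
      Measure.prod_apply (measurable_fst.prodMk hk hA)]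
    refine lintegral_congr fun v => ?_
    rw [Kernel.map_apply _ hk, Kernel.prod_apply, Kernel.const_apply, Kernel.id_apply,
      Measure.dirac_prod, Measure.map_map hk measurable_prodMk_left,
      Measure.map_apply (hk.comp measurable_prodMk_left) (measurable_prodMk_left hA)]
    rfl
  · rw [Kernel.map_apply _ hk, Kernel.prod_apply, Kernel.const_apply, Kernel.id_apply,
      Measure.dirac_prod, Measure.map_map hk measurable_prodMk_left]
    exact isGaussianProcessWith_kriging hG hK hs v

/-- The laws given the pattern form a Markov kernel. -/
lemma exists_kernel_isPatternLaw (hf : IsDensityFamily X f) (hX : MeasurableSet X)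
    (hG : IsGaussianProcessWith (fun (s : S) (y : C(S, ℝ)) => y s) m K G) :
    ∃ κ : Kernel (PointPattern S) C(S, ℝ), IsMarkovKernel κ ∧
      ∀ (N : PointPattern S) (n : ℕ) (s : Fin n → S), Function.Injective s →
        range s = (N.points : Set S) → IsPatternLaw f m K s (κ N) := by
  have := hG.gaussian.isProbabilityMeasure
  let Kc : C(S, C(S, ℝ)) := ContinuousMap.curry
    ⟨fun p => K p.2 p.1, hG.continuous_cov.comp continuous_swap⟩
  have hK (x t : S) : Kc x t = K t x := rfl
  -- The chosen enumeration need not be measurable. The law does not depend on it, so measurability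
  -- can be tested on arbitrary injective tuples.
  choose card enum henum hpat using PointPattern.exists_eq_ofTuple (S := S)
  choose κ hκ using exists_kernel_eq_patternLaw hf hX Kc G
  have heq (N : PointPattern S) (n : ℕ) (s : Fin n → S) (hs : Function.Injective s)
      (h : range s = (N.points : Set S)) :
      patternLaw f Kc G (enum N) = patternLaw f Kc G s := by
    refine patternLaw_eq_of_ofTuple_eq hf (henum N) hs ?_
    rw [h, ← PointPattern.coe_points_ofTuple, hpat]
  refine ⟨⟨fun N => patternLaw f Kc G (enum N), ?_⟩, ⟨fun N => ?_⟩, fun N n s hs h => ?_⟩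
  · refine PointPattern.measurable_of_ofTuple (fun n s => κ n s) (fun n => (κ n).measurable)
      fun n s hs => ?_
    rw [hκ n s hs]
    exact heq _ n s hs (PointPattern.coe_points_ofTuple s).symm
  · exact isProbabilityMeasure_patternLaw hf (henum N)
  · change IsPatternLaw f m K s (patternLaw f Kc G (enum N))
    rw [heq N n s hs h]
    exact isPatternLaw_patternLaw hf hG hK hs

/-! ### Assembling the mixture -/

theorem exists_isPOGAMP (leb : Measure S) [NullSingletonClass leb] {lam : S → ℝ}
    (hlam : Integrable lam leb) (hf : IsDensityFamily X f) (hX : MeasurableSet X)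
    (hG : IsGaussianProcessWith (fun (s : S) (y : C(S, ℝ)) => y s) m K G) :
    ∃ P : Measure (C(S, ℝ) × PointPattern S),
      IsProbabilityMeasure P ∧ IsPOGAMP leb lam f m K P ∧
        IsStochasticProcess (fun (s : S) (ω : C(S, ℝ) × PointPattern S) => ω.1 s) P := by
  obtain ⟨κ, _, hκ⟩ := exists_kernel_isPatternLaw hf hX hG
  set L := leb.withDensity fun s => ENNReal.ofReal (lam s)
  have : IsFiniteMeasure L := isFiniteMeasure_withDensity_ofReal hlam.2
  have : NullSingletonClass L :=
    ⟨fun x => withDensity_absolutelyContinuous _ _ (measure_singleton x)⟩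
  -- The composition product lists the pattern first; the swap puts the path first. Its
  -- disintegration along the pattern is `κ` by construction.
  set P := (PointPattern.poissonLaw L ⊗ₘ κ).map Prod.swap with hP
  have hPP : IsProbabilityMeasure P := Measure.isProbabilityMeasure_map measurable_swap.aemeasurable
  have hsnd : P.map Prod.snd = PointPattern.poissonLaw L := by
    rw [hP, Measure.map_map measurable_snd measurable_swap]
    exact Measure.fst_compProd _ _
  have heval (s : S) : Measurable fun ω : C(S, ℝ) × PointPattern S => ω.1 s :=
    (Continuous.measurable (by fun_prop : Continuous fun y : C(S, ℝ) => y s)).comp measurable_fst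
  refine ⟨P, hPP, ⟨.of_map measurable_snd ?_, κ, inferInstance, ⟨by fun_prop, ?_⟩,
    Eventually.of_forall hκ⟩, heval, ?_⟩
  · rw [hsnd]
    exact PointPattern.isPoissonProcess_poissonLaw L
  · rw [hsnd, hP, Measure.map_map (measurable_snd.prodMk measurable_fst) measurable_swap]
    exact Measure.map_id
  · exact isProjectiveMeasureFamily_map_restrict fun t => (heval t).aemeasurable

end PatternLaw

theorem mainTheorem1 {d : ℕ} (hd : 1 ≤ d) (S : Set (EuclideanSpace ℝ (Fin d))) (hS : IsCompact S)
    (lam : S → ℝ) (hlam_nonneg : ∀ s, 0 ≤ lam s)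
    (hlam_int : Integrable lam (Measure.comap Subtype.val volume))
    (X : Set ℝ) (hX : MeasurableSet X)
    (f : ∀ n : ℕ, (Fin n → S) → (Fin n → ℝ) → ℝ) (hf : IsDensityFamily X f)
    (m : S → ℝ) (K : S → S → ℝ)
    (G : Measure C(S, ℝ)) (hG : IsGaussianProcessWith (fun (s : S) (y : C(S, ℝ)) => y s) m K G) :
    ∃ P : Measure (C(S, ℝ) × PointPattern S),
      IsProbabilityMeasure P ∧ IsPOGAMP (Measure.comap Subtype.val volume) lam f m K P ∧
        IsStochasticProcess (fun (s : S) (ω : C(S, ℝ) × PointPattern S) => ω.1 s) P := by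
  have := isCompact_iff_compactSpace.1 hS
  have := hS.isClosed.polishSpace
  -- Positive dimension makes Lebesgue measure atomless; in dimension 0 it would charge the single
  -- point.
  have : Nonempty (Fin d) := ⟨⟨0, hd⟩⟩
  have : NullSingletonClass (Measure.comap (Subtype.val : S → EuclideanSpace ℝ (Fin d)) volume) :=
    ⟨fun x => by
      rw [(MeasurableEmbedding.subtype_coe hS.measurableSet).comap_apply, image_singleton,
        measure_singleton]⟩
  exact exists_isPOGAMP _ hlam_int hf hX hG
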